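/- Let $M$ be a $\sigma$-compact metric space. A family $\mathcal U=\{U_j\}_{j\in J}$ of open sets that covers $M$ is a good covering if it is locally finite, each closure $\overline{U_j}$ is compact, and every nonempty intersection $V=U_{j_0}\cap\dots\cap U_{j_k}$ of finitely many members ($k\ge 0$) has a center, that is, a point $p\in V$ for which there is a Lipschitz map $F:V\times[0,1]\to V$ with $F(x,0)=x$, $F(x,1)=p$ and $F(p,t)=p$ for all $x\in V$, $t\in[0,1]$. The nerve $\mathcal N_{\mathcal U}$ is the abstract simplicial complex whose simplices are the nonempty finite sets $\{j_0,\dots,j_k\}\subset J$ with $U_{j_0}\cap\dots\cap U_{j_k}\neq\emptyset$. Its geometric realization $|\mathcal N_{\mathcal U}|$ is the set of functions $\theta:J\to[0,1]$ whose support is a simplex of $\mathcal N_{\mathcal U}$ and which satisfy $\sum_j\theta(j)=1$, with the metric $d(\theta,\theta')=\sup_j|\theta(j)-\theta'(j)|$. Maps $h_0,h_1:X\to Y$ of metric spaces are (locally) Lipschitz homotopic if $h_0=h(\cdot,0)$ and $h_1=h(\cdot,1)$ for a (locally) Lipschitz map $h:X\times[0,1]\to Y$. A (locally) Lipschitz map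 $f:X\to Y$ is a (locally) Lipschitz homotopy equivalence if there is a (locally) Lipschitz map $g:Y\to X$ such that $g\circ f$ and $f\circ g$ are (locally) Lipschitz homotopic to the identity maps; $X$ and $Y$ have the same (locally) Lipschitz homotopy type if such an $f$ exists. Theorem 1.1. If $\mathcal U=\{U_j\}_{j\in J}$ is a good covering of the $\sigma$-compact metric space $M$, then $M$ has the same locally Lipschitz homotopy type as $|\mathcal N_{\mathcal U}|$. If moreover $M$ is compact, then $M$ has the same Lipschitz homotopy type as $|\mathcal N_{\mathcal U}|$. More precisely, if $M$ is compact and nonempty, choose any center $p_j$ of $U_j$ for each $j$ with $U_j\neq\emptyset$, and put $$f_j(x)=\frac{d(x,M\setminus U_j)}{d(x,M\setminus U_j)+d(x,p_j)},\qquad \xi_j=\frac{f_j}{\sum_{i}f_i},$$ where $f_j=1$ if $U_j=M$ and $f_j=0$ if $U_j=\emptyset$. Then $\Theta(x)=(\xi_j(x))_{j\in J}$ defines a map $\Theta:M\to|\mathcal N_{\mathcal U}|$, and this map is a Lipschitz homotopy equivalence. -/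

import Mathlib

open Set
open scoped unitInterval ENNReal Topology

noncomputable section

namespace LipNerve

/-! ### Homotopies in the category of (locally) Lipschitz maps -/

section Homotopy

variable {X Y : Type*} [MetricSpace X] [MetricSpace Y]

/-- `f` is Lipschitz, with some Lipschitz constant. -/
def IsLipschitz (f : X → Y) : Prop := ∃ K : NNReal, LipschitzWith K f

/-- `F : X × [0,1] → X` is a Lipschitz strong deformation retraction of `X` to `A`. -/
structure IsLipschitzStrongDeformationRetraction (A : Set X) (F : X × I → X) : Prop where
  lipschitz : IsLipschitz F
  apply_zero : ∀ x, F (x, 0) = x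
  apply_one_mem : ∀ x, F (x, 1) ∈ A
  apply_of_mem : ∀ a ∈ A, ∀ t, F (a, t) = a

/-- The maps `h₀` and `h₁` are Lipschitz homotopic. -/
def LipschitzHomotopic (h₀ h₁ : X → Y) : Prop :=
  ∃ h : X × I → Y, IsLipschitz h ∧ (∀ x, h (x, 0) = h₀ x) ∧ ∀ x, h (x, 1) = h₁ x

/-- The maps `h₀` and `h₁` are locally Lipschitz homotopic. -/
def LocLipschitzHomotopic (h₀ h₁ : X → Y) : Prop :=
  ∃ h : X × I → Y, LocallyLipschitz h ∧ (∀ x, h (x, 0) = h₀ x) ∧ ∀ x, h (x, 1) = h₁ x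

/-- `f` is a Lipschitz homotopy equivalence. -/
def IsLipschitzHomotopyEquivalence (f : X → Y) : Prop :=
  IsLipschitz f ∧ ∃ g : Y → X, IsLipschitz g ∧
    LipschitzHomotopic (g ∘ f) id ∧ LipschitzHomotopic (f ∘ g) id

/-- `f` is a locally Lipschitz homotopy equivalence. -/
def IsLocLipschitzHomotopyEquivalence (f : X → Y) : Prop :=
  LocallyLipschitz f ∧ ∃ g : Y → X, LocallyLipschitz g ∧
    LocLipschitzHomotopic (g ∘ f) id ∧ LocLipschitzHomotopic (f ∘ g) id

end Homotopy

/-- `X` and `Y` have the same Lipschitz homotopy type. -/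
def LipschitzHomotopyEquivalent (X Y : Type*) [MetricSpace X] [MetricSpace Y] : Prop :=
  ∃ f : X → Y, IsLipschitzHomotopyEquivalence f

/-- `X` and `Y` have the same locally Lipschitz homotopy type. -/
def LocLipschitzHomotopyEquivalent (X Y : Type*) [MetricSpace X] [MetricSpace Y] : Prop :=
  ∃ f : X → Y, IsLocLipschitzHomotopyEquivalence f

/-! ### Good coverings -/

section Cover

variable {M : Type*} [MetricSpace M] {J : Type*}

/-- `p` is a center of `V`: the subspace `V` has a Lipschitz strong deformation retraction to its
point `p`. -/
def IsCenter (V : Set M) (p : M) : Prop :=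
  ∃ hp : p ∈ V, ∃ F : V × I → V,
    IsLipschitzStrongDeformationRetraction ({⟨p, hp⟩} : Set V) F

/-- `U` is a good covering of the metric space `M`. -/
structure IsGoodCovering (U : J → Set M) : Prop where
  isOpen : ∀ j, IsOpen (U j)
  covers : ⋃ j, U j = univ
  locallyFinite : LocallyFinite U
  isCompact_closure : ∀ j, IsCompact (closure (U j))
  exists_center : ∀ s : Finset J, s.Nonempty → (⋂ j ∈ s, U j).Nonempty →
    ∃ p, IsCenter (⋂ j ∈ s, U j) p

/-- The nerve of the family `U`: its simplices are the nonempty finite sets of indices whose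
members have a common point; in particular its vertices are the `j` with `U j` nonempty. -/
def nerve (U : J → Set M) : PreAbstractSimplicialComplex J where
  faces := {s | s.Nonempty ∧ (⋂ j ∈ s, U j).Nonempty}
  isRelLowerSet_faces := fun _ hs =>
    ⟨hs.1, fun _ hts ht => ⟨ht, hs.2.mono (biInter_subset_biInter_left hts)⟩⟩

end Cover

/-! ### Geometric realization and the partition-of-unity map -/

/-- The geometric realization of `K`, as a set of functions `θ` on the vertices in barycentric
coordinates: `θ ≥ 0`, the support of `θ` is a simplex of `K`, and the values of `θ` sum to `1`.
It lies in the bounded real functions with the supremum norm, so that its distance is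
`d(θ, θ') = sup_i |θ i - θ' i|`. -/
def realization {ι : Type*} (K : PreAbstractSimplicialComplex ι) :
    Set (lp (fun _ : ι => ℝ) ∞) :=
  {θ | (∀ i, 0 ≤ θ i) ∧ ∃ s ∈ K, Function.support (fun i => θ i) = ↑s ∧ ∑ i ∈ s, θ i = 1}

section Partition

variable {M : Type*} [MetricSpace M] {J : Type*}

open Classical in
/-- The function `f_j(x) = |x, U_jᶜ| / (|x, U_jᶜ| + |x, p_j|)`. When the complement of `U_j` is
empty, the distance to it is `+∞` and the quotient is read as `1`. -/
def bump (U : J → Set M) (p : J → M) (j : J) (x : M) : ℝ :=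
  if (U j)ᶜ = ∅ then 1
  else Metric.infDist x (U j)ᶜ / (Metric.infDist x (U j)ᶜ + dist x (p j))

/-- The partition of unity `ξ_j = f_j / ∑ i, f_i`. -/
def partition (U : J → Set M) (p : J → M) (j : J) (x : M) : ℝ :=
  bump U p j x / ∑ᶠ i, bump U p i x

end Partition

end LipNerve

end

/-!
The coordinates of `Θ` are a locally Lipschitz partition of unity with `ξ_j > 0` exactly on `U j`;
this is all that is used about `Θ` in `isLocLipschitzHomotopyEquivalence_of_pos_iff`. The compact
case reduces to the local one, since then `M` and the nerve are compact and locally Lipschitz maps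
between compact spaces are Lipschitz.

A homotopy inverse `g` is built from the contractions of the intersections `U_ρ = ⋂ j ∈ ρ, U j`.
For a point `θ` of the nerve the superlevel sets `{i | θ i > c}`, `c ≥ 0`, form a flag of faces of
the carrier of `θ`. Start at some point of `U_{carrier θ}` and apply the contractions of the `U_ρ`,
for `ρ` in the flag, in the order of decreasing dimension. This is possible since `U_ρ` grows when
`ρ` shrinks. The contraction of `U_ρ` runs for a time `flagWeight θ ρ` proportional to the
interval of thresholds that give `ρ`; it is cut off at time `1`, and the weights are normalized so
that close to any point some `ρ` is contracted completely. Hence the end point `g θ` does not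
depend on the starting point. It depends on `θ` in a locally Lipschitz way
(`ContractionSystem.exists_lipschitzOnWith_step`): where the flag changes, the weights of the
simplices that enter or leave it are small, and a contraction applied for a short time moves points
little.

* `g ∘ Θ` is homotopic to the identity: let the same composite of contractions, for `θ = Θ x`, start
  at `x` itself, with all times multiplied by a factor between `0` and `1`.
* `Θ ∘ g` is homotopic to the identity: `g θ` lies in `U j` if `θ j` is maximal, hence the products
  `ξ_j (g θ) * θ j`, divided by their sum, are the coordinates of a point `ψ θ` of the nerve whose
  carrier lies in that of `θ` and in that of `Θ (g θ)`. So the segments from `ψ θ` to both points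
  lie in the nerve.

Near each point of `M` or of the nerve only finitely many members of the covering matter, because
the covering is locally finite and its members are relatively compact. This makes the Lipschitz
constants locally uniform.
-/

noncomputable section

namespace LipNerve

open Filter
open scoped NNReal

/-! ### Maps that are Lipschitz near a point -/

section LipschitzNear

variable {X Y Z : Type*} [PseudoMetricSpace X] [PseudoMetricSpace Y] [PseudoMetricSpace Z]

/-- `f` is Lipschitz on some neighbourhood of `x`; `LocallyLipschitz f` says this at every `x`. -/
def LipschitzNear (f : X → Y) (x : X) : Prop :=
  ∃ K : ℝ≥0, ∃ t ∈ 𝓝 x, LipschitzOnWith K f t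

namespace LipschitzNear

lemma continuousAt {f : X → Y} {x : X} (hf : LipschitzNear f x) : ContinuousAt f x := by
  obtain ⟨K, t, ht, h⟩ := hf
  exact h.continuousOn.continuousAt ht

lemma of_lipschitzWith {f : X → Y} {K : ℝ≥0} (hf : LipschitzWith K f) (x : X) :
    LipschitzNear f x :=
  ⟨K, univ, univ_mem, hf.lipschitzOnWith⟩

lemma const (y : Y) (x : X) : LipschitzNear (fun _ : X => y) x :=
  of_lipschitzWith (LipschitzWith.const y) x

lemma comp {g : Y → Z} {f : X → Y} {x : X} (hg : LipschitzNear g (f x))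
    (hf : LipschitzNear f x) : LipschitzNear (fun a => g (f a)) x := by
  have hc := hf.continuousAt
  obtain ⟨K, t, ht, hK⟩ := hg
  obtain ⟨L, s, hs, hL⟩ := hf
  exact ⟨K * L, s ∩ f ⁻¹' t, inter_mem hs (hc ht),
    hK.comp (hL.mono inter_subset_left) fun _ h => h.2⟩

lemma prodMk {f : X → Y} {g : X → Z} {x : X} (hf : LipschitzNear f x)
    (hg : LipschitzNear g x) : LipschitzNear (fun a => (f a, g a)) x := by
  obtain ⟨K, t, ht, hK⟩ := hf
  obtain ⟨L, s, hs, hL⟩ := hg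
  exact ⟨max K L, t ∩ s, inter_mem ht hs,
    (hK.mono inter_subset_left).prodMk (hL.mono inter_subset_right)⟩

lemma congr {f g : X → Y} {x : X} (hf : LipschitzNear f x) (h : g =ᶠ[𝓝 x] f) :
    LipschitzNear g x := by
  obtain ⟨K, t, ht, hK⟩ := hf
  refine ⟨K, t ∩ {a | g a = f a}, inter_mem ht h, fun a ha b hb => ?_⟩
  rw [ha.2, hb.2]
  exact hK ha.1 hb.1

lemma fst (x : X × Y) : LipschitzNear (Prod.fst : X × Y → X) x :=
  of_lipschitzWith LipschitzWith.prod_fst x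

lemma snd (x : X × Y) : LipschitzNear (Prod.snd : X × Y → Y) x :=
  of_lipschitzWith LipschitzWith.prod_snd x

lemma mul {f g : X → ℝ} {x : X} (hf : LipschitzNear f x) (hg : LipschitzNear g x) :
    LipschitzNear (fun a => f a * g a) x :=
  have h : ContDiffAt ℝ 1 (fun p : ℝ × ℝ => p.1 * p.2) (f x, g x) :=
    contDiffAt_fst.mul contDiffAt_snd
  comp (g := fun p : ℝ × ℝ => p.1 * p.2) (f := fun a => (f a, g a)) h.exists_lipschitzOnWith
    (hf.prodMk hg)

lemma div {f g : X → ℝ} {x : X} (hf : LipschitzNear f x) (hg : LipschitzNear g x)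
    (h0 : g x ≠ 0) : LipschitzNear (fun a => f a / g a) x :=
  have h : ContDiffAt ℝ 1 (fun p : ℝ × ℝ => p.1 / p.2) (f x, g x) :=
    contDiffAt_fst.div contDiffAt_snd h0
  comp (g := fun p : ℝ × ℝ => p.1 / p.2) (f := fun a => (f a, g a)) h.exists_lipschitzOnWith
    (hf.prodMk hg)

variable {E : Type*} [NormedAddCommGroup E] [NormedSpace ℝ E]

lemma add {f g : X → E} {x : X} (hf : LipschitzNear f x) (hg : LipschitzNear g x) :
    LipschitzNear (fun a => f a + g a) x :=
  have h : ContDiffAt ℝ 1 (fun p : E × E => p.1 + p.2) (f x, g x) :=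
    contDiffAt_fst.add contDiffAt_snd
  comp (g := fun p : E × E => p.1 + p.2) (f := fun a => (f a, g a)) h.exists_lipschitzOnWith
    (hf.prodMk hg)

lemma sub {f g : X → E} {x : X} (hf : LipschitzNear f x) (hg : LipschitzNear g x) :
    LipschitzNear (fun a => f a - g a) x :=
  have h : ContDiffAt ℝ 1 (fun p : E × E => p.1 - p.2) (f x, g x) :=
    contDiffAt_fst.sub contDiffAt_snd
  comp (g := fun p : E × E => p.1 - p.2) (f := fun a => (f a, g a)) h.exists_lipschitzOnWith
    (hf.prodMk hg)

lemma smul {f : X → ℝ} {g : X → E} {x : X} (hf : LipschitzNear f x) (hg : LipschitzNear g x) :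
    LipschitzNear (fun a => f a • g a) x :=
  have h : ContDiffAt ℝ 1 (fun p : ℝ × E => p.1 • p.2) (f x, g x) :=
    contDiffAt_fst.smul contDiffAt_snd
  comp (g := fun p : ℝ × E => p.1 • p.2) (f := fun a => (f a, g a)) h.exists_lipschitzOnWith
    (hf.prodMk hg)

lemma sum {ι : Type*} {f : ι → X → ℝ} {x : X} (s : Finset ι)
    (hf : ∀ i ∈ s, LipschitzNear (f i) x) : LipschitzNear (fun a => ∑ i ∈ s, f i a) x := by
  classical
  induction s using Finset.induction_on with
  | empty => simpa using const (0 : ℝ) x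
  | insert i s hi ih =>
    simp only [Finset.sum_insert hi]
    exact (hf i (Finset.mem_insert_self i s)).add
      (ih fun j hj => hf j (Finset.mem_insert_of_mem hj))

/-- A map into bounded functions is Lipschitz near `x` if near `x` only finitely many coordinates
are nonzero and each of these is Lipschitz near `x`. -/
lemma of_coord {ι : Type*} {f : X → lp (fun _ : ι => ℝ) ∞} {x : X} (s : Finset ι)
    (hs : ∀ᶠ a in 𝓝 x, ∀ i ∉ s, f a i = 0) (hf : ∀ i, LipschitzNear (fun a => f a i) x) :
    LipschitzNear f x := by
  choose K t ht hK using hf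
  refine ⟨∑ i ∈ s, K i, {a | ∀ i ∉ s, f a i = 0} ∩ ⋂ i ∈ s, t i,
    inter_mem hs ((biInter_finset_mem s).2 fun i _ => ht i), ?_⟩
  rw [LipschitzOnWith.coordinate]
  intro i
  by_cases hi : i ∈ s
  · have hsub : ({a | ∀ i ∉ s, f a i = 0} ∩ ⋂ i ∈ s, t i) ⊆ t i :=
      fun a ha => mem_iInter₂.1 ha.2 i hi
    exact ((hK i).mono hsub).weaken (Finset.single_le_sum (fun _ _ => zero_le) hi)
  · intro a ha b hb
    simp [ha.1 i hi, hb.1 i hi]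

end LipschitzNear

lemma IsLipschitz.of_locallyLipschitz {X Y : Type*} [MetricSpace X] [MetricSpace Y]
    [CompactSpace X] {f : X → Y} (hf : LocallyLipschitz f) : IsLipschitz f := by
  obtain ⟨K, hK⟩ := (hf.locallyLipschitzOn (s := univ)).exists_lipschitzOnWith_of_compact
    isCompact_univ
  exact ⟨K, lipschitzOnWith_univ.1 hK⟩

end LipschitzNear

/-! ### The geometric realization -/

section Realization

variable {J : Type*} {K : PreAbstractSimplicialComplex J}

lemma mem_realization_of {θ : lp (fun _ : J => ℝ) ∞} (h0 : ∀ i, 0 ≤ θ i) {s : Finset J}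
    (hs : s ∈ K) (hsupp : ∀ i ∉ s, θ i = 0) (hsum : ∑ i ∈ s, θ i = 1) : θ ∈ realization K := by
  classical
  set t := s.filter fun i => θ i ≠ 0 with ht
  have hsumt : ∑ i ∈ t, θ i = 1 := by rw [ht, Finset.sum_filter_ne_zero, hsum]
  have htne : t.Nonempty := by
    rw [Finset.nonempty_iff_ne_empty]
    rintro h
    simp [h] at hsumt
  refine ⟨h0, t, (K.isRelLowerSet_faces hs).2 (Finset.filter_subset _ _) htne, ?_, hsumt⟩
  ext i
  simp only [Function.mem_support, ht, Finset.coe_filter, mem_ofPred_eq]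
  exact ⟨fun h => ⟨by_contra fun hi => h (hsupp i hi), h⟩, fun h => h.2⟩

/-- The simplex on which the point `θ` of the realization has positive coordinates. -/
def carrier (θ : realization K) : Finset J := θ.2.2.choose

lemma carrier_mem (θ : realization K) : carrier θ ∈ K := θ.2.2.choose_spec.1

lemma coord_nonneg (θ : realization K) (i : J) : 0 ≤ θ.1 i := θ.2.1 i

lemma mem_carrier {θ : realization K} {i : J} : i ∈ carrier θ ↔ 0 < θ.1 i := by
  rw [(coord_nonneg θ i).lt_iff_ne', ← Finset.mem_coe, carrier, ← θ.2.2.choose_spec.2.1,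
    Function.mem_support]

lemma coord_eq_zero {θ : realization K} {i : J} (h : i ∉ carrier θ) : θ.1 i = 0 :=
  le_antisymm (not_lt.1 fun h' => h (mem_carrier.2 h')) (coord_nonneg θ i)

lemma sum_coord {θ : realization K} {s : Finset J} (h : carrier θ ⊆ s) :
    ∑ i ∈ s, θ.1 i = 1 :=
  (Finset.sum_subset (f := fun i => θ.1 i) h fun _ _ hi => coord_eq_zero hi).symm.trans
    θ.2.2.choose_spec.2.2

lemma carrier_nonempty (θ : realization K) : (carrier θ).Nonempty :=
  (K.isRelLowerSet_faces (carrier_mem θ)).1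

lemma coord_le_one (θ : realization K) (i : J) : θ.1 i ≤ 1 := by
  by_cases hi : i ∈ carrier θ
  · rw [← sum_coord (Finset.Subset.refl (carrier θ))]
    exact Finset.single_le_sum (f := fun i => θ.1 i) (fun j _ => coord_nonneg θ j) hi
  · rw [coord_eq_zero hi]
    exact zero_le_one

lemma abs_coord_sub_le (θ θ' : realization K) (i : J) : |θ.1 i - θ'.1 i| ≤ dist θ θ' := by
  rw [Subtype.dist_eq, dist_eq_norm]
  exact lp.norm_apply_le_norm ENNReal.top_ne_zero (θ.1 - θ'.1) i

lemma lipschitzWith_coord (i : J) : LipschitzWith 1 fun θ : realization K => θ.1 i :=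
  LipschitzWith.of_dist_le_mul fun θ θ' => by
    simpa [Real.dist_eq] using abs_coord_sub_le θ θ' i

/-- The point of the realization with given barycentric coordinates. -/
def ofWeights (f : J → ℝ) (h0 : ∀ i, 0 ≤ f i) (s : Finset J) (hs : s ∈ K)
    (hsupp : ∀ i ∉ s, f i = 0) (hsum : ∑ i ∈ s, f i = 1) : realization K :=
  ⟨⟨f, memℓp_infty ⟨1, by
    rintro _ ⟨i, rfl⟩
    change ‖f i‖ ≤ 1
    rw [Real.norm_of_nonneg (h0 i)]
    by_cases hi : i ∈ s
    · rw [← hsum]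
      exact Finset.single_le_sum (fun j _ => h0 j) hi
    · rw [hsupp i hi]
      exact zero_le_one⟩⟩,
    mem_realization_of h0 hs hsupp hsum⟩

/-- The segment between two points of a common closed simplex lies in the realization. -/
lemma segment_mem_realization {a b : realization K} {s : Finset J} (hs : s ∈ K)
    (ha : carrier a ⊆ s) (hb : carrier b ⊆ s) {t : ℝ} (h0 : 0 ≤ t) (h1 : t ≤ 1) :
    a.1 + t • (b.1 - a.1) ∈ realization K := by
  have key : ∀ i, (a.1 + t • (b.1 - a.1)) i = (1 - t) * a.1 i + t * b.1 i := by
    intro i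
    change a.1 i + t * (b.1 i - a.1 i) = _
    ring
  refine mem_realization_of (fun i => ?_) hs (fun i hi => ?_) ?_
  · rw [key]
    have := coord_nonneg a i
    have := coord_nonneg b i
    have : 0 ≤ 1 - t := by linarith
    positivity
  · rw [key, coord_eq_zero fun h => hi (ha h), coord_eq_zero fun h => hi (hb h)]
    simp
  · simp only [key]
    rw [Finset.sum_add_distrib, ← Finset.mul_sum, ← Finset.mul_sum, sum_coord ha, sum_coord hb]
    ring

/-- A complex with finitely many simplices has a compact realization: it is the union of the
finitely many closed simplices, which are continuous images of standard simplices. -/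
lemma compactSpace_realization (hK : K.faces.Finite) : CompactSpace (realization K) := by
  classical
  rw [← isCompact_iff_compactSpace]
  let ext : (s : Finset J) → (s → ℝ) →ₗ[ℝ] lp (fun _ : J => ℝ) ∞ := fun s =>
    ∑ i : s, (lp.lsingle (𝕜 := ℝ) (E := fun _ : J => ℝ) ∞ (i : J)).comp (LinearMap.proj i)
  have ext_apply : ∀ (s : Finset J) (c : s → ℝ) (j : J),
      ext s c j = if h : j ∈ s then c ⟨j, h⟩ else 0 := by
    intro s c j
    have h1 : ext s c = ∑ i : s, lp.single (E := fun _ : J => ℝ) ∞ (i : J) (c i) := by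
      simp [ext, LinearMap.sum_apply]
    rw [h1, lp.coeFn_sum, Finset.sum_apply]
    split_ifs with h
    · rw [Finset.sum_eq_single ⟨j, h⟩]
      · simp
      · intro b _ hb
        rw [lp.single_apply_ne]
        exact fun e => hb (Subtype.ext e.symm)
      · simp
    · refine Finset.sum_eq_zero fun b _ => ?_
      rw [lp.single_apply_ne]
      rintro rfl
      exact h b.2
  have hunion : realization K = ⋃ s ∈ K.faces, ext s '' stdSimplex ℝ s := by
    ext θ
    simp only [mem_iUnion, mem_image, exists_prop]
    constructor
    · intro hθ
      let θ' : realization K := ⟨θ, hθ⟩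
      refine ⟨carrier θ', carrier_mem θ', fun i => θ i, ⟨fun i => hθ.1 i, ?_⟩, ?_⟩
      · rw [Finset.sum_coe_sort (carrier θ') fun i => θ i]
        exact sum_coord (θ := θ') (Finset.Subset.refl _)
      · ext j
        rw [ext_apply]
        split_ifs with h
        · rfl
        · exact (coord_eq_zero h).symm
    · rintro ⟨s, hs, c, hc, rfl⟩
      refine mem_realization_of (fun i => ?_) hs (fun i hi => ?_) ?_
      · rw [ext_apply]
        split_ifs
        exacts [hc.1 _, le_rfl]
      · rw [ext_apply, dif_neg hi]
      · rw [← hc.2, ← Finset.sum_coe_sort s]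
        exact Finset.sum_congr rfl fun i _ => by rw [ext_apply, dif_pos i.2]
  rw [hunion]
  exact hK.isCompact_biUnion fun s _ =>
    (isCompact_stdSimplex ℝ s).image (ext s).continuous_of_finiteDimensional

end Realization

/-! ### The partition of unity -/

section Partition

variable {M : Type*} [MetricSpace M] {J : Type*} {U : J → Set M} {p : J → M}

lemma bump_nonneg (j : J) (x : M) : 0 ≤ bump U p j x := by
  unfold bump
  split_ifs
  · exact zero_le_one
  · exact div_nonneg Metric.infDist_nonneg (add_nonneg Metric.infDist_nonneg dist_nonneg)

lemma bump_pos_iff (hU : IsGoodCovering U) {j : J} {x : M} : 0 < bump U p j x ↔ x ∈ U j := by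
  unfold bump
  split_ifs with h
  · simp [compl_empty_iff.1 h]
  · have hpos : 0 < Metric.infDist x (U j)ᶜ ↔ x ∈ U j := by
      rw [← (hU.isOpen j).isClosed_compl.notMem_iff_infDist_pos (nonempty_iff_ne_empty.2 h),
        notMem_compl_iff]
    rw [← hpos]
    constructor
    · intro hx
      refine lt_of_le_of_ne Metric.infDist_nonneg fun h0 => ?_
      rw [← h0, zero_div] at hx
      exact hx.false
    · exact fun hx => div_pos hx (add_pos_of_pos_of_nonneg hx dist_nonneg)

lemma bump_eq_zero (hU : IsGoodCovering U) {j : J} {x : M} (h : x ∉ U j) : bump U p j x = 0 :=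
  le_antisymm (not_lt.1 fun h' => h ((bump_pos_iff hU).1 h')) (bump_nonneg j x)

lemma lipschitzNear_bump (hU : IsGoodCovering U) (hp : ∀ j, (U j).Nonempty → p j ∈ U j)
    (j : J) (x : M) : LipschitzNear (bump U p j) x := by
  by_cases h : (U j)ᶜ = ∅
  · have : bump U p j = fun _ => 1 := by
      ext y
      simp [bump, h]
    rw [this]
    exact .const _ _
  by_cases hne : (U j).Nonempty
  · have hb : bump U p j = fun y =>
        Metric.infDist y (U j)ᶜ / (Metric.infDist y (U j)ᶜ + dist y (p j)) := by
      ext y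
      simp [bump, h]
    rw [hb]
    have h1 : LipschitzNear (fun y => Metric.infDist y (U j)ᶜ) x :=
      .of_lipschitzWith (Metric.lipschitz_infDist_pt _) x
    have h2 : LipschitzNear (fun y => dist y (p j)) x :=
      .of_lipschitzWith (LipschitzWith.dist_left (p j)) x
    refine h1.div (h1.add h2) (ne_of_gt ?_)
    by_cases hx : x ∈ U j
    · have := ((hU.isOpen j).isClosed_compl.notMem_iff_infDist_pos
        (nonempty_iff_ne_empty.2 h)).1 (notMem_compl_iff.2 hx)
      exact add_pos_of_pos_of_nonneg this dist_nonneg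
    · refine add_pos_of_nonneg_of_pos Metric.infDist_nonneg (dist_pos.2 ?_)
      rintro rfl
      exact hx (hp j hne)
  · have : bump U p j = fun _ => 0 := by
      ext y
      exact bump_eq_zero hU fun hy => hne ⟨y, hy⟩
    rw [this]
    exact .const _ _

lemma finsum_bump_eq (hU : IsGoodCovering U) {x : M} {s : Finset J} (hs : ∀ j, x ∈ U j → j ∈ s) :
    ∑ᶠ i, bump U p i x = ∑ i ∈ s, bump U p i x := by
  refine finsum_eq_sum_of_support_subset _ fun i hi => hs i ?_
  by_contra h
  exact hi (bump_eq_zero hU h)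

lemma exists_mem (hU : IsGoodCovering U) (x : M) : ∃ j, x ∈ U j :=
  mem_iUnion.1 (hU.covers ▸ mem_univ x)

lemma finsum_bump_pos (hU : IsGoodCovering U) (x : M) : 0 < ∑ᶠ i, bump U p i x := by
  have hfin := hU.locallyFinite.point_finite x
  rw [finsum_bump_eq hU (s := hfin.toFinset) fun j hj => hfin.mem_toFinset.2 hj]
  obtain ⟨j, hj⟩ := exists_mem hU x
  exact Finset.sum_pos' (fun i _ => bump_nonneg i x)
    ⟨j, hfin.mem_toFinset.2 hj, (bump_pos_iff hU).2 hj⟩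

lemma partition_pos_iff (hU : IsGoodCovering U) {j : J} {x : M} :
    0 < partition U p j x ↔ x ∈ U j := by
  rw [partition, div_pos_iff_of_pos_right (finsum_bump_pos hU x), bump_pos_iff hU]

lemma lipschitzNear_partition (hU : IsGoodCovering U) (hp : ∀ j, (U j).Nonempty → p j ∈ U j)
    (j : J) (x : M) : LipschitzNear (partition U p j) x := by
  obtain ⟨t, ht, hfin⟩ := hU.locallyFinite x
  have hsum : LipschitzNear (fun y => ∑ᶠ i, bump U p i y) x := by
    refine (LipschitzNear.sum hfin.toFinset fun i _ => lipschitzNear_bump hU hp i x).congr ?_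
    filter_upwards [ht] with y hy
    exact finsum_bump_eq hU fun j hj => hfin.mem_toFinset.2 ⟨y, hj, hy⟩
  exact (lipschitzNear_bump hU hp j x).div hsum (finsum_bump_pos hU x).ne'

/-- The partition of unity is the coordinate form of a locally Lipschitz map to the nerve. -/
lemma exists_partition_map (hU : IsGoodCovering U) (hp : ∀ j, (U j).Nonempty → p j ∈ U j) :
    ∃ Θ : M → realization (nerve U), (∀ x j, (Θ x).1 j = partition U p j x) ∧
      LocallyLipschitz Θ := by
  have h0 : ∀ x j, 0 ≤ partition U p j x := fun x j =>
    div_nonneg (bump_nonneg j x) (finsum_bump_pos hU x).le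
  have hout : ∀ x j, x ∉ U j → partition U p j x = 0 := fun x j hx => by
    rw [partition, bump_eq_zero hU hx, zero_div]
  let s : M → Finset J := fun x => (hU.locallyFinite.point_finite x).toFinset
  have hs : ∀ x j, j ∈ s x ↔ x ∈ U j := fun x j =>
    (hU.locallyFinite.point_finite x).mem_toFinset
  let Θ : M → realization (nerve U) := fun x =>
    ofWeights (fun j => partition U p j x) (h0 x) (s x)
      ⟨(exists_mem hU x).imp fun j hj => (hs x j).2 hj,
        x, mem_iInter₂.2 fun j hj => (hs x j).1 hj⟩
      (fun j hj => hout x j fun h => hj ((hs x j).2 h))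
      (by
        simp only [partition]
        rw [← Finset.sum_div, ← finsum_bump_eq hU fun j hj => (hs x j).2 hj]
        exact div_self (finsum_bump_pos hU x).ne')
  refine ⟨Θ, fun x j => rfl, fun x => ?_⟩
  obtain ⟨t, ht, hfin⟩ := hU.locallyFinite x
  refine LipschitzNear.of_coord (f := fun y => (Θ y).1) hfin.toFinset ?_
    fun j => lipschitzNear_partition hU hp j x
  filter_upwards [ht] with y hy j hj
  exact hout y j fun h => hj (hfin.mem_toFinset.2 ⟨y, h, hy⟩)

end Partition

/-! ### Successive contraction along a flag of simplices -/

section Contraction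

variable {M J : Type*} {U : J → Set M}

/-- The simplices of positive weight belong to the nerve and form a flag. -/
structure IsFlagWeight (U : J → Set M) (w : Finset J → ℝ) : Prop where
  mem_nerve : ∀ ρ, 0 < w ρ → ρ ∈ nerve U
  chain : ∀ ρ τ, 0 < w ρ → 0 < w τ → ρ ⊆ τ ∨ τ ⊆ ρ

lemma IsFlagWeight.eq_of_card_eq {w : Finset J → ℝ} (hw : IsFlagWeight U w) {ρ τ : Finset J}
    (hρ : 0 < w ρ) (hτ : 0 < w τ) (h : ρ.card = τ.card) : ρ = τ := by
  rcases hw.chain ρ τ hρ hτ with hs | hs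
  · exact Finset.eq_of_subset_of_card_le hs h.ge
  · exact (Finset.eq_of_subset_of_card_le hs h.le).symm

/-- The point `z` lies in the intersection belonging to each simplex of positive weight with at
most `k` vertices. -/
def IsAdmissible (U : J → Set M) (w : Finset J → ℝ) (k : ℕ) (z : M) : Prop :=
  ∀ ρ, 0 < w ρ → ρ.card ≤ k → z ∈ ⋂ j ∈ ρ, U j

variable [MetricSpace M]

/-- A choice of Lipschitz contractions of all the nonempty finite intersections of members of `U`.
They are extended to all points of `M` (without any condition outside the intersection) and to all
real times, being constant for times `≤ 0` and for times `≥ 1`. The center of the contraction is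
not named: it is the common value at times `≥ 1`. -/
structure ContractionSystem (U : J → Set M) where
  /-- The contraction of the intersection belonging to a simplex. -/
  contract : Finset J → M → ℝ → M
  /-- A Lipschitz constant of the contraction. -/
  const : Finset J → ℝ≥0
  contract_of_nonpos : ∀ ρ z r, r ≤ 0 → contract ρ z r = z
  contract_mem : ∀ ρ ∈ nerve U, ∀ z ∈ ⋂ j ∈ ρ, U j, ∀ r, contract ρ z r ∈ ⋂ j ∈ ρ, U j
  contract_of_one_le : ∀ ρ ∈ nerve U, ∀ z ∈ ⋂ j ∈ ρ, U j, ∀ z' ∈ ⋂ j ∈ ρ, U j, ∀ r r',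
    1 ≤ r → 1 ≤ r' → contract ρ z r = contract ρ z' r'
  dist_contract_le : ∀ ρ ∈ nerve U, ∀ z ∈ ⋂ j ∈ ρ, U j, ∀ z' ∈ ⋂ j ∈ ρ, U j, ∀ r r',
    dist (contract ρ z r) (contract ρ z' r') ≤ const ρ * (dist z z' + |r - r'|)

lemma IsGoodCovering.nonempty_contractionSystem (hU : IsGoodCovering U) :
    Nonempty (ContractionSystem U) := by
  classical
  have key : ∀ ρ : Finset J, ∃ (c : M → ℝ → M) (L : ℝ≥0),
      (∀ z r, r ≤ 0 → c z r = z) ∧ (ρ ∈ nerve U →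
        (∀ z ∈ ⋂ j ∈ ρ, U j, ∀ r, c z r ∈ ⋂ j ∈ ρ, U j) ∧
        (∀ z ∈ ⋂ j ∈ ρ, U j, ∀ z' ∈ ⋂ j ∈ ρ, U j, ∀ r r',
          1 ≤ r → 1 ≤ r' → c z r = c z' r') ∧
        ∀ z ∈ ⋂ j ∈ ρ, U j, ∀ z' ∈ ⋂ j ∈ ρ, U j, ∀ r r',
          dist (c z r) (c z' r') ≤ L * (dist z z' + |r - r'|)) := by
    intro ρ
    by_cases hρ : ρ ∈ nerve U
    · obtain ⟨p, hp, F, ⟨L, hL⟩, hF0, hF1, -⟩ := hU.exists_center ρ hρ.1 hρ.2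
      have hc : ∀ (z : M) (hz : z ∈ ⋂ j ∈ ρ, U j) (r : ℝ),
          (if h : z ∈ ⋂ j ∈ ρ, U j then (F (⟨z, h⟩, projIcc 0 1 zero_le_one r) : M) else z) =
            F (⟨z, hz⟩, projIcc 0 1 zero_le_one r) := fun z hz r => dif_pos hz
      refine ⟨fun z r => if h : z ∈ ⋂ j ∈ ρ, U j then
        (F (⟨z, h⟩, projIcc 0 1 zero_le_one r) : M) else z, L, ?_, fun _ => ⟨?_, ?_, ?_⟩⟩
      · intro z r hr
        dsimp only
        split_ifs with h
        · rw [projIcc_of_le_left _ hr]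
          exact congrArg Subtype.val (hF0 ⟨z, h⟩)
        · rfl
      · intro z hz r
        dsimp only
        rw [hc z hz]
        exact Subtype.coe_prop _
      · intro z hz z' hz' r r' hr hr'
        dsimp only
        rw [hc z hz, hc z' hz', projIcc_of_right_le _ hr, projIcc_of_right_le _ hr']
        exact congrArg Subtype.val ((hF1 ⟨z, hz⟩).trans (hF1 ⟨z', hz'⟩).symm)
      · intro z hz z' hz' r r'
        dsimp only
        rw [hc z hz, hc z' hz', ← Subtype.dist_eq]
        refine (hL.dist_le_mul _ _).trans ?_
        gcongr
        rw [Prod.dist_eq]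
        refine max_le ?_ ?_
        · exact le_add_of_nonneg_right (abs_nonneg _)
        · refine le_add_of_nonneg_of_le dist_nonneg ?_
          simpa [Real.dist_eq] using
            (LipschitzWith.projIcc (zero_le_one' ℝ)).dist_le_mul r r'
    · exact ⟨fun z _ => z, 0, fun _ _ _ => rfl, fun h => absurd h hρ⟩
  choose c L h0 h using key
  exact ⟨⟨c, L, h0, fun ρ hρ => (h ρ hρ).1, fun ρ hρ => (h ρ hρ).2.1,
    fun ρ hρ => (h ρ hρ).2.2⟩⟩

namespace ContractionSystem

variable (C : ContractionSystem U)

open Classical in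
/-- Contract along the simplex with `k` vertices of positive weight, if there is one, for a time
equal to its weight. -/
def step (w : Finset J → ℝ) (k : ℕ) (z : M) : M :=
  if h : ∃ ρ : Finset J, ρ.card = k ∧ 0 < w ρ then C.contract h.choose z (w h.choose) else z

/-- Contract along the simplices of positive weight with at most `N` vertices, in the order of
decreasing dimension. -/
def descend (w : Finset J → ℝ) : ℕ → M → M
  | 0, z => z
  | k + 1, z => descend w k (C.step w (k + 1) z)

variable {C} {w : Finset J → ℝ}

lemma step_of_pos (hw : IsFlagWeight U w) {ρ : Finset J} (hρ : 0 < w ρ) (z : M) :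
    C.step w ρ.card z = C.contract ρ z (w ρ) := by
  have h : ∃ τ : Finset J, τ.card = ρ.card ∧ 0 < w τ := ⟨ρ, rfl, hρ⟩
  rw [step, dif_pos h, hw.eq_of_card_eq h.choose_spec.2 hρ h.choose_spec.1]

lemma step_of_forall {k : ℕ} (h : ∀ ρ : Finset J, ρ.card = k → w ρ ≤ 0) (z : M) :
    C.step w k z = z :=
  dif_neg fun ⟨ρ, hρ, hpos⟩ => (h ρ hρ).not_gt hpos

lemma step_cases (hw : IsFlagWeight U w) (k : ℕ) :
    (∃ ρ : Finset J, ρ.card = k ∧ 0 < w ρ ∧ ∀ z, C.step w k z = C.contract ρ z (w ρ)) ∨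
      ∀ z, C.step w k z = z := by
  by_cases h : ∃ ρ : Finset J, ρ.card = k ∧ 0 < w ρ
  · obtain ⟨ρ, rfl, hρ⟩ := h
    exact .inl ⟨ρ, rfl, hρ, step_of_pos hw hρ⟩
  · push Not at h
    exact .inr (step_of_forall h)

lemma isAdmissible_step (hw : IsFlagWeight U w) {k : ℕ} {z : M}
    (hz : IsAdmissible U w (k + 1) z) : IsAdmissible U w k (C.step w (k + 1) z) := by
  intro τ hτ hcard
  rcases step_cases (C := C) hw (k + 1) with ⟨ρ, hρk, hρ, h⟩ | h
  · have hsub : τ ⊆ ρ := by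
      rcases hw.chain ρ τ hρ hτ with hs | hs
      · have := Finset.card_le_card hs
        omega
      · exact hs
    rw [h]
    exact biInter_subset_biInter_left hsub
      (C.contract_mem ρ (hw.mem_nerve ρ hρ) z (hz ρ hρ hρk.le) _)
  · rw [h]
    exact hz τ hτ (by omega)

lemma descend_of_nonpos (hw : ∀ ρ, w ρ ≤ 0) (N : ℕ) (z : M) : C.descend w N z = z := by
  induction N with
  | zero => rfl
  | succ k ih => rw [descend, step_of_forall fun ρ _ => hw ρ, ih]

lemma descend_eq_of_le {n N : ℕ} (hw : ∀ ρ : Finset J, n < ρ.card → w ρ ≤ 0) (h : n ≤ N)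
    (z : M) : C.descend w N z = C.descend w n z := by
  induction N, h using Nat.le_induction with
  | base => rfl
  | succ k hk ih => rw [descend, step_of_forall (fun ρ hρ => hw ρ (by omega)), ih]

/-- Once some simplex is contracted completely, the starting point is forgotten. -/
lemma descend_eq_of_one_le (hw : IsFlagWeight U w) {ρ : Finset J} (hρ : 1 ≤ w ρ) {N : ℕ}
    (hN : ρ.card ≤ N) {z z' : M} (hz : IsAdmissible U w N z) (hz' : IsAdmissible U w N z') :
    C.descend w N z = C.descend w N z' := by
  have hρ0 : 0 < w ρ := zero_lt_one.trans_le hρ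
  induction N generalizing z z' with
  | zero =>
    have hne := (hw.mem_nerve ρ hρ0).1
    rw [Nat.le_zero, Finset.card_eq_zero] at hN
    exact absurd hN hne.ne_empty
  | succ k ih =>
    rw [descend, descend]
    rcases hN.eq_or_lt with h | h
    · rw [← h, step_of_pos hw hρ0, step_of_pos hw hρ0,
        C.contract_of_one_le ρ (hw.mem_nerve ρ hρ0) z (hz ρ hρ0 hN) z' (hz' ρ hρ0 hN) _ _ hρ hρ]
    · exact ih (by omega) (isAdmissible_step hw hz) (isAdmissible_step hw hz')

lemma descend_mem (hw : IsFlagWeight U w) {j : J} (hj : ∀ ρ, 0 < w ρ → j ∈ ρ) {N : ℕ} {z : M}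
    (hz : IsAdmissible U w N z) (hzj : z ∈ U j) : C.descend w N z ∈ U j := by
  induction N generalizing z with
  | zero => exact hzj
  | succ k ih =>
    refine ih (isAdmissible_step hw hz) ?_
    rcases step_cases (C := C) hw (k + 1) with ⟨ρ, hρk, hρ, h⟩ | h
    · rw [h]
      exact mem_iInter₂.1
        (C.contract_mem ρ (hw.mem_nerve ρ hρ) z (hz ρ hρ hρk.le) (w ρ)) j (hj ρ hρ)
    · rw [h]
      exact hzj

section Lipschitz

variable {P : Type*} [PseudoMetricSpace P] {A : Set P} {v : P → Finset J → ℝ} {z : P → M}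
  {L Kw Kz : ℝ≥0}

/-- One contraction step depends in a Lipschitz way on parameters. Two parameters at which the same
simplex is used are compared by the Lipschitz constant of its contraction; otherwise the weight of
the simplex used at one parameter vanishes at the other one, so that it is small and the step moves
the point little. -/
lemma exists_lipschitzOnWith_step (hw : ∀ a ∈ A, IsFlagWeight U (v a))
    (hL : ∀ a ∈ A, ∀ ρ, 0 < v a ρ → C.const ρ ≤ L)
    (hv : ∀ ρ, LipschitzOnWith Kw (fun a => v a ρ) A) (hz : LipschitzOnWith Kz z A) {k : ℕ}
    (hadm : ∀ a ∈ A, IsAdmissible U (v a) k (z a)) :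
    ∃ K, LipschitzOnWith K (fun a => C.step (v a) k (z a)) A := by
  have hv' : ∀ ρ, ∀ a ∈ A, ∀ b ∈ A, |v a ρ - v b ρ| ≤ Kw * dist a b := fun ρ a ha b hb => by
    simpa [Real.dist_eq] using (hv ρ).dist_le_mul a ha b hb
  have hmove : ∀ a ∈ A, ∀ b ∈ A, (∀ ρ : Finset J, ρ.card = k → 0 < v a ρ → v b ρ ≤ 0) →
      dist (C.step (v a) k (z a)) (z a) ≤ L * (Kw * dist a b) := by
    intro a ha b hb hab
    rcases step_cases (C := C) (hw a ha) k with ⟨ρ, hρk, hρ, h⟩ | h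
    · have hmem := hadm a ha ρ hρ hρk.le
      have h1 := C.dist_contract_le ρ ((hw a ha).mem_nerve ρ hρ) _ hmem _ hmem (v a ρ) 0
      rw [C.contract_of_nonpos ρ _ 0 le_rfl, dist_self, zero_add, sub_zero, abs_of_pos hρ] at h1
      have h2 : v a ρ ≤ Kw * dist a b := by
        have := hab ρ hρk hρ
        have := (le_abs_self _).trans (hv' ρ a ha b hb)
        linarith
      rw [h]
      refine h1.trans ?_
      gcongr
      exact hL a ha ρ hρ
    · rw [h, dist_self]
      positivity
  refine ⟨Kz + L * (Kz + 2 * Kw), LipschitzOnWith.of_dist_le_mul fun a ha b hb => ?_⟩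
  push_cast
  have hzab := hz.dist_le_mul a ha b hb
  have h1 : (0 : ℝ) ≤ Kz * dist a b := by positivity
  have h2 : (0 : ℝ) ≤ L * Kw * dist a b := by positivity
  have h3 : (0 : ℝ) ≤ L * Kz * dist a b := by positivity
  by_cases hcommon : ∃ ρ : Finset J, ρ.card = k ∧ 0 < v a ρ ∧ 0 < v b ρ
  · obtain ⟨ρ, rfl, hρa, hρb⟩ := hcommon
    rw [step_of_pos (hw a ha) hρa, step_of_pos (hw b hb) hρb]
    have hstep : dist (C.contract ρ (z a) (v a ρ)) (C.contract ρ (z b) (v b ρ)) ≤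
        L * (Kz * dist a b + Kw * dist a b) := by
      refine (C.dist_contract_le ρ ((hw a ha).mem_nerve ρ hρa) _ (hadm a ha ρ hρa le_rfl) _
        (hadm b hb ρ hρb le_rfl) _ _).trans ?_
      gcongr
      exacts [hL a ha ρ hρa, hv' ρ a ha b hb]
    linarith
  · push Not at hcommon
    have ha' := hmove a ha b hb hcommon
    have hb' := hmove b hb a ha fun ρ hρ hb0 =>
      not_lt.1 fun ha0 => (hcommon ρ hρ ha0).not_gt hb0
    rw [dist_comm b a] at hb'
    have htri := dist_triangle4 (C.step (v a) k (z a)) (z a) (z b) (C.step (v b) k (z b))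
    rw [dist_comm (z b) (C.step (v b) k (z b))] at htri
    linarith

lemma exists_lipschitzOnWith_descend (hw : ∀ a ∈ A, IsFlagWeight U (v a))
    (hL : ∀ a ∈ A, ∀ ρ, 0 < v a ρ → C.const ρ ≤ L)
    (hv : ∀ ρ, LipschitzOnWith Kw (fun a => v a ρ) A) {N : ℕ} (hz : LipschitzOnWith Kz z A)
    (hadm : ∀ a ∈ A, IsAdmissible U (v a) N (z a)) :
    ∃ K, LipschitzOnWith K (fun a => C.descend (v a) N (z a)) A := by
  induction N generalizing z Kz with
  | zero => exact ⟨Kz, hz⟩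
  | succ k ih =>
    obtain ⟨K, hK⟩ := exists_lipschitzOnWith_step hw hL hv hz hadm
    exact ih hK fun a ha => isAdmissible_step (hw a ha) (hadm a ha)

/-- If some simplex is contracted completely for all parameters, no regularity of the starting
point is needed: after that contraction the point is constant. -/
lemma exists_lipschitzOnWith_descend_of_one_le (hw : ∀ a ∈ A, IsFlagWeight U (v a))
    (hL : ∀ a ∈ A, ∀ ρ, 0 < v a ρ → C.const ρ ≤ L)
    (hv : ∀ ρ, LipschitzOnWith Kw (fun a => v a ρ) A) {N : ℕ}
    (hadm : ∀ a ∈ A, IsAdmissible U (v a) N (z a)) {ρ : Finset J} (hρN : ρ.card ≤ N)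
    (hρ : ∀ a ∈ A, 1 ≤ v a ρ) :
    ∃ K, LipschitzOnWith K (fun a => C.descend (v a) N (z a)) A := by
  rcases A.eq_empty_or_nonempty with rfl | ⟨a₀, ha₀⟩
  · exact ⟨0, lipschitzOnWith_empty 0 _⟩
  have hρ0 : ∀ a ∈ A, 0 < v a ρ := fun a ha => zero_lt_one.trans_le (hρ a ha)
  induction N generalizing z with
  | zero =>
    rw [Nat.le_zero, Finset.card_eq_zero] at hρN
    exact absurd hρN ((hw a₀ ha₀).mem_nerve ρ (hρ0 a₀ ha₀)).1.ne_empty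
  | succ k ih =>
    have hadm' : ∀ a ∈ A, IsAdmissible U (v a) k (C.step (v a) (k + 1) (z a)) :=
      fun a ha => isAdmissible_step (hw a ha) (hadm a ha)
    rcases hρN.eq_or_lt with h | h
    · change ∃ K, LipschitzOnWith K (fun a => C.descend (v a) k (C.step (v a) (k + 1) (z a))) A
      refine exists_lipschitzOnWith_descend (Kz := 0) hw hL hv ?_ hadm'
      refine LipschitzOnWith.of_dist_le_mul fun a ha b hb => ?_
      rw [← h, step_of_pos (hw a ha) (hρ0 a ha), step_of_pos (hw b hb) (hρ0 b hb),
        C.contract_of_one_le ρ ((hw a ha).mem_nerve ρ (hρ0 a ha)) _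
          (hadm a ha ρ (hρ0 a ha) hρN) _ (hadm b hb ρ (hρ0 b hb) hρN) _ _ (hρ a ha) (hρ b hb)]
      simp
    · exact ih hadm' (by omega)

end Lipschitz

end ContractionSystem

end Contraction

/-! ### Weights of superlevel sets -/

section Gap

variable {J : Type*}

/-- The length of the interval of thresholds `c ≥ 0` for which `ρ` is the set of all `i` with
`θ i > c`: the minimum of `θ` on `ρ` minus its supremum outside `ρ`, if this is positive. For
`ρ = ∅` the infimum is `0` by convention, and so is the gap. -/
def gap (θ : J → ℝ) (ρ : Finset J) : ℝ :=
  max 0 ((⨅ i : ρ, θ i) - ⨆ j : {j // j ∉ ρ}, θ j)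

lemma gap_nonneg (θ : J → ℝ) (ρ : Finset J) : 0 ≤ gap θ ρ := le_max_left _ _

lemma bddAbove_range_compl {θ : J → ℝ} (h1 : ∀ i, θ i ≤ 1) (ρ : Finset J) :
    BddAbove (range fun j : {j // j ∉ ρ} => θ j) :=
  ⟨1, by rintro _ ⟨j, rfl⟩; exact h1 j⟩

lemma iInf_le_coord (θ : J → ℝ) {ρ : Finset J} {i : J} (hi : i ∈ ρ) : ⨅ i : ρ, θ i ≤ θ i :=
  ciInf_le (Set.finite_range fun i : ρ => θ i).bddBelow ⟨i, hi⟩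

lemma nonempty_of_gap_pos {θ : J → ℝ} (h0 : ∀ i, 0 ≤ θ i) {ρ : Finset J} (h : 0 < gap θ ρ) :
    ρ.Nonempty := by
  rw [Finset.nonempty_iff_ne_empty]
  rintro rfl
  have h1 : 0 ≤ ⨆ j : {j : J // j ∉ (∅ : Finset J)}, θ j := Real.iSup_nonneg fun j => h0 j
  rw [gap, Real.iInf_of_isEmpty, max_eq_left (by linarith)] at h
  exact h.false

lemma lt_of_gap_pos {θ : J → ℝ} (h1 : ∀ i, θ i ≤ 1) {ρ : Finset J} (h : 0 < gap θ ρ) {i j : J}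
    (hi : i ∈ ρ) (hj : j ∉ ρ) : θ j < θ i := by
  have h' : 0 < (⨅ i : ρ, θ i) - ⨆ j : {j // j ∉ ρ}, θ j := by
    simpa [gap] using h
  have hj' : θ j ≤ ⨆ j : {j // j ∉ ρ}, θ j := le_ciSup (bddAbove_range_compl h1 ρ) ⟨j, hj⟩
  have := iInf_le_coord θ hi
  linarith

lemma pos_of_gap_pos {θ : J → ℝ} (h0 : ∀ i, 0 ≤ θ i) {ρ : Finset J} (h : 0 < gap θ ρ) {i : J}
    (hi : i ∈ ρ) : 0 < θ i := by
  have h' : 0 < (⨅ i : ρ, θ i) - ⨆ j : {j // j ∉ ρ}, θ j := by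
    simpa [gap] using h
  have hs : 0 ≤ ⨆ j : {j // j ∉ ρ}, θ j := Real.iSup_nonneg fun j => h0 j
  have := iInf_le_coord θ hi
  linarith

lemma gap_le_one {θ : J → ℝ} (h0 : ∀ i, 0 ≤ θ i) (h1 : ∀ i, θ i ≤ 1) (ρ : Finset J) :
    gap θ ρ ≤ 1 := by
  refine max_le zero_le_one ?_
  have hs : 0 ≤ ⨆ j : {j // j ∉ ρ}, θ j := Real.iSup_nonneg fun j => h0 j
  have hi : ⨅ i : ρ, θ i ≤ 1 := by
    rcases ρ.eq_empty_or_nonempty with rfl | ⟨i, hi⟩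
    · rw [Real.iInf_of_isEmpty]
      exact zero_le_one
    · exact (iInf_le_coord θ hi).trans (h1 i)
  linarith

lemma gap_le_add {θ θ' : J → ℝ} (h0 : ∀ i, 0 ≤ θ i) (h1 : ∀ i, θ i ≤ 1) {d : ℝ} (hd : 0 ≤ d)
    (h : ∀ i, |θ i - θ' i| ≤ d) (ρ : Finset J) : gap θ ρ ≤ gap θ' ρ + 2 * d := by
  rcases (gap_nonneg θ ρ).eq_or_lt with hg | hg
  · have := gap_nonneg θ' ρ
    linarith
  have : Nonempty ρ := (nonempty_of_gap_pos h0 hg).to_subtype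
  have hinf : (⨅ i : ρ, θ i) - d ≤ ⨅ i : ρ, θ' i := by
    refine le_ciInf fun i => ?_
    have := iInf_le_coord θ i.2
    have := abs_le.1 (h i)
    linarith
  have hsup : ⨆ j : {j // j ∉ ρ}, θ' j ≤ (⨆ j : {j // j ∉ ρ}, θ j) + d := by
    refine Real.iSup_le (fun j => ?_) (add_nonneg (Real.iSup_nonneg fun j => h0 j) hd)
    have : θ j ≤ ⨆ j : {j // j ∉ ρ}, θ j := le_ciSup (bddAbove_range_compl h1 ρ) j
    have := abs_le.1 (h j)
    linarith
  have hg' : gap θ ρ = (⨅ i : ρ, θ i) - ⨆ j : {j // j ∉ ρ}, θ j := by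
    rw [gap, max_eq_right]
    by_contra hneg
    rw [gap, max_eq_left (not_le.1 hneg).le] at hg
    exact hg.false
  have := le_max_right 0 ((⨅ i : ρ, θ' i) - ⨆ j : {j // j ∉ ρ}, θ' j)
  rw [hg']
  change _ ≤ max 0 _ + 2 * d
  linarith

end Gap

section FlagWeight

variable {J : Type*} {K : PreAbstractSimplicialComplex J}

/-- The largest gap of a point of the realization. -/
def maxGap (θ : realization K) : ℝ := ⨆ ρ, gap (fun i => θ.1 i) ρ

/-- The gaps, normalized so that the largest one becomes `2`. Then some simplex has weight `≥ 1`
not only at a given point but also, by continuity, in a neighbourhood of it. -/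
def flagWeight (θ : realization K) (ρ : Finset J) : ℝ :=
  2 * (gap (fun i => θ.1 i) ρ / maxGap θ)

lemma gap_le_maxGap (θ : realization K) (ρ : Finset J) :
    gap (fun i => θ.1 i) ρ ≤ maxGap θ :=
  le_ciSup (f := fun ρ => gap (fun i => θ.1 i) ρ)
    ⟨1, by rintro _ ⟨τ, rfl⟩; exact gap_le_one (coord_nonneg θ) (coord_le_one θ) τ⟩ ρ

lemma maxGap_pos (θ : realization K) : 0 < maxGap θ := by
  refine lt_of_lt_of_le ?_ (gap_le_maxGap θ (carrier θ))
  have : Nonempty (carrier θ) := (carrier_nonempty θ).to_subtype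
  obtain ⟨i, hi⟩ := exists_eq_ciInf_of_finite (f := fun i : carrier θ => θ.1 i)
  have hsup : ⨆ j : {j // j ∉ carrier θ}, θ.1 j ≤ 0 :=
    Real.iSup_nonpos fun j => (coord_eq_zero j.2).le
  have hpos : 0 < θ.1 i := mem_carrier.1 i.2
  refine lt_max_of_lt_right ?_
  rw [← hi]
  linarith

lemma gap_le_add_dist (θ θ' : realization K) (ρ : Finset J) :
    gap (fun i => θ.1 i) ρ ≤ gap (fun i => θ'.1 i) ρ + 2 * dist θ θ' :=
  gap_le_add (coord_nonneg θ) (coord_le_one θ) dist_nonneg (abs_coord_sub_le θ θ') ρ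

lemma abs_gap_sub_le (θ θ' : realization K) (ρ : Finset J) :
    |gap (fun i => θ.1 i) ρ - gap (fun i => θ'.1 i) ρ| ≤ 2 * dist θ θ' := by
  have h1 := gap_le_add_dist θ θ' ρ
  have h2 := gap_le_add_dist θ' θ ρ
  rw [dist_comm] at h2
  exact abs_sub_le_iff.2 ⟨by linarith, by linarith⟩

lemma abs_maxGap_sub_le (θ θ' : realization K) : |maxGap θ - maxGap θ'| ≤ 2 * dist θ θ' := by
  have key : ∀ θ θ' : realization K, maxGap θ ≤ maxGap θ' + 2 * dist θ θ' := fun θ θ' =>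
    ciSup_le fun ρ => (gap_le_add_dist θ θ' ρ).trans (by gcongr; exact gap_le_maxGap θ' ρ)
  have h1 := key θ θ'
  have h2 := key θ' θ
  rw [dist_comm] at h2
  exact abs_sub_le_iff.2 ⟨by linarith, by linarith⟩

lemma flagWeight_nonneg (θ : realization K) (ρ : Finset J) : 0 ≤ flagWeight θ ρ :=
  mul_nonneg zero_le_two (div_nonneg (gap_nonneg _ ρ) (maxGap_pos θ).le)

lemma flagWeight_le_two (θ : realization K) (ρ : Finset J) : flagWeight θ ρ ≤ 2 := by
  have : gap (fun i => θ.1 i) ρ / maxGap θ ≤ 1 :=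
    div_le_one_of_le₀ (gap_le_maxGap θ ρ) (maxGap_pos θ).le
  unfold flagWeight
  linarith

lemma gap_pos_of_flagWeight_pos {θ : realization K} {ρ : Finset J} (h : 0 < flagWeight θ ρ) :
    0 < gap (fun i => θ.1 i) ρ := by
  refine lt_of_le_of_ne (gap_nonneg _ ρ) fun h0 => ?_
  rw [flagWeight, ← h0, zero_div, mul_zero] at h
  exact h.false

lemma subset_carrier {θ : realization K} {ρ : Finset J} (h : 0 < flagWeight θ ρ) :
    ρ ⊆ carrier θ := fun _ hi =>
  mem_carrier.2 (pos_of_gap_pos (coord_nonneg θ) (gap_pos_of_flagWeight_pos h) hi)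

/-- A vertex with maximal barycentric coordinate lies in all simplices of positive weight. -/
lemma exists_forall_mem (θ : realization K) :
    ∃ j ∈ carrier θ, ∀ ρ, 0 < flagWeight θ ρ → j ∈ ρ := by
  obtain ⟨j, hj, hmax⟩ := (carrier θ).exists_max_image (fun i => θ.1 i) (carrier_nonempty θ)
  refine ⟨j, hj, fun ρ hρ => by_contra fun hjρ => ?_⟩
  have hgap := gap_pos_of_flagWeight_pos hρ
  obtain ⟨i, hi⟩ := nonempty_of_gap_pos (coord_nonneg θ) hgap
  exact (lt_of_gap_pos (coord_le_one θ) hgap hi hjρ).not_ge (hmax i (subset_carrier hρ hi))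

lemma flagWeight_chain {θ : realization K} {ρ τ : Finset J} (hρ : 0 < flagWeight θ ρ)
    (hτ : 0 < flagWeight θ τ) : ρ ⊆ τ ∨ τ ⊆ ρ := by
  by_contra! h
  obtain ⟨i, hiρ, hiτ⟩ := Finset.not_subset.1 h.1
  obtain ⟨j, hjτ, hjρ⟩ := Finset.not_subset.1 h.2
  exact lt_asymm (lt_of_gap_pos (coord_le_one θ) (gap_pos_of_flagWeight_pos hρ) hiρ hjρ)
    (lt_of_gap_pos (coord_le_one θ) (gap_pos_of_flagWeight_pos hτ) hjτ hiτ)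

/-- The weights are Lipschitz near each point, with a constant independent of the simplex. -/
lemma exists_lipschitzOnWith_flagWeight (θ₀ : realization K) :
    ∃ C : ℝ≥0, ∃ t ∈ 𝓝 θ₀, ∀ ρ, LipschitzOnWith C (fun θ : realization K => flagWeight θ ρ) t := by
  set m := maxGap θ₀ / 2 with hm
  have hm0 : 0 < m := half_pos (maxGap_pos θ₀)
  refine ⟨⟨8 / m, by positivity⟩, {θ | m ≤ maxGap θ}, ?_, fun ρ =>
    LipschitzOnWith.of_dist_le_mul fun a ha b hb => ?_⟩
  · filter_upwards [Metric.ball_mem_nhds θ₀ (half_pos hm0)] with θ hθ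
    have h1 := abs_le.1 (abs_maxGap_sub_le θ θ₀)
    have h2 := Metric.mem_ball.1 hθ
    change m ≤ maxGap θ
    linarith
  · have ha0 := maxGap_pos a
    have hb0 := maxGap_pos b
    have ha' : m ≤ maxGap a := ha
    set ga := gap (fun i => a.1 i) ρ
    set gb := gap (fun i => b.1 i) ρ
    have hq0 : 0 ≤ gb / maxGap b := div_nonneg (gap_nonneg _ ρ) hb0.le
    have hq1 : gb / maxGap b ≤ 1 := div_le_one_of_le₀ (gap_le_maxGap b ρ) hb0.le
    have hid : ga / maxGap a - gb / maxGap b =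
        ((ga - gb) + gb / maxGap b * (maxGap b - maxGap a)) / maxGap a := by
      field_simp
      ring
    have hnum : |(ga - gb) + gb / maxGap b * (maxGap b - maxGap a)| ≤ 4 * dist a b := by
      refine (abs_add_le _ _).trans ?_
      rw [abs_mul, abs_of_nonneg hq0, abs_sub_comm (maxGap b)]
      have h1 := abs_gap_sub_le a b ρ
      have h2 := mul_le_mul hq1 (abs_maxGap_sub_le a b) (abs_nonneg _) zero_le_one
      linarith
    rw [Real.dist_eq, flagWeight, flagWeight, ← mul_sub, hid, abs_mul, abs_two, abs_div,
      abs_of_pos ha0]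
    calc 2 * (|(ga - gb) + gb / maxGap b * (maxGap b - maxGap a)| / maxGap a)
        ≤ 2 * (4 * dist a b / m) := by gcongr
      _ = 8 / m * dist a b := by ring

lemma exists_eventually_one_le_flagWeight (θ₀ : realization K) :
    ∃ ρ ⊆ carrier θ₀, ∀ᶠ θ in 𝓝 θ₀, 1 ≤ flagWeight θ ρ := by
  obtain ⟨ρ, hρ⟩ := exists_lt_of_lt_ciSup (f := fun ρ => gap (fun i => θ₀.1 i) ρ)
    (half_lt_self (maxGap_pos θ₀))
  change maxGap θ₀ / 2 < _ at hρ
  have h1 : 1 < flagWeight θ₀ ρ := by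
    have : 1 / 2 < gap (fun i => θ₀.1 i) ρ / maxGap θ₀ := by
      rw [lt_div_iff₀ (maxGap_pos θ₀)]
      linarith
    unfold flagWeight
    linarith
  refine ⟨ρ, subset_carrier (zero_lt_one.trans h1), ?_⟩
  obtain ⟨C, t, ht, hC⟩ := exists_lipschitzOnWith_flagWeight θ₀
  have hcont : ContinuousAt (fun θ : realization K => flagWeight θ ρ) θ₀ :=
    LipschitzNear.continuousAt ⟨C, t, ht, hC ρ⟩
  exact (hcont.eventually_const_lt h1).mono fun _ h => h.le

end FlagWeight

/-! ### The homotopy equivalence -/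

section Main

variable {M J : Type*} {U : J → Set M}

lemma mem_nerve_of_subset_carrier {θ : realization (nerve U)} {ρ : Finset J}
    (hne : ρ.Nonempty) (h : ρ ⊆ carrier θ) : ρ ∈ nerve U :=
  ((nerve U).isRelLowerSet_faces (carrier_mem θ)).2 h hne

lemma isFlagWeight_flagWeight (θ : realization (nerve U)) {τ : ℝ} (hτ : 0 ≤ τ) :
    IsFlagWeight U fun ρ => τ * flagWeight θ ρ where
  mem_nerve _ h :=
    have hρ := pos_of_mul_pos_right h hτ
    mem_nerve_of_subset_carrier
      (nonempty_of_gap_pos (coord_nonneg θ) (gap_pos_of_flagWeight_pos hρ)) (subset_carrier hρ)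
  chain _ _ h h' :=
    flagWeight_chain (pos_of_mul_pos_right h hτ) (pos_of_mul_pos_right h' hτ)

lemma isAdmissible_flagWeight {θ : realization (nerve U)} {τ : ℝ} (hτ : 0 ≤ τ) {z : M}
    (hz : z ∈ ⋂ j ∈ carrier θ, U j) (N : ℕ) :
    IsAdmissible U (fun ρ => τ * flagWeight θ ρ) N z := fun _ h _ =>
  biInter_subset_biInter_left (subset_carrier (pos_of_mul_pos_right h hτ)) hz

variable [MetricSpace M]

/-- Near a point of the realization of the nerve only finitely many coordinates are nonzero. -/
lemma exists_eventually_carrier_subset (hU : IsGoodCovering U) (θ₀ : realization (nerve U)) :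
    ∃ S : Finset J, ∀ᶠ θ in 𝓝 θ₀, carrier θ ⊆ S := by
  obtain ⟨j, hj⟩ := carrier_nonempty θ₀
  have hfin := hU.locallyFinite.finite_nonempty_inter_compact (hU.isCompact_closure j)
  refine ⟨hfin.toFinset, ?_⟩
  have hev : ∀ᶠ θ : realization (nerve U) in 𝓝 θ₀, 0 < θ.1 j :=
    (lipschitzWith_coord j).continuous.continuousAt.eventually_const_lt (mem_carrier.1 hj)
  filter_upwards [hev] with θ hθ i hi
  obtain ⟨x, hx⟩ := (carrier_mem θ).2
  rw [mem_iInter₂] at hx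
  exact hfin.mem_toFinset.2 ⟨x, hx i hi, subset_closure (hx j (mem_carrier.2 hθ))⟩

namespace ContractionSystem

variable (C : ContractionSystem U)

/-- Starting at `z`, contract along the flag of superlevel sets of `θ`, at speed `τ`. -/
def deform (θ : realization (nerve U)) (τ : ℝ) (z : M) : M :=
  C.descend (fun ρ => τ * flagWeight θ ρ) (carrier θ).card z

lemma deform_eq_descend {θ : realization (nerve U)} {τ : ℝ} (hτ : 0 ≤ τ) {N : ℕ}
    (hN : (carrier θ).card ≤ N) (z : M) :
    C.deform θ τ z = C.descend (fun ρ => τ * flagWeight θ ρ) N z := by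
  refine (descend_eq_of_le (fun ρ hρ => not_lt.1 fun h => ?_) hN z).symm
  exact hρ.not_ge (Finset.card_le_card (subset_carrier (pos_of_mul_pos_right h hτ)))

lemma deform_zero (θ : realization (nerve U)) (z : M) : C.deform θ 0 z = z :=
  descend_of_nonpos (fun ρ => by simp) _ z

lemma deform_one_eq (θ : realization (nerve U)) {z z' : M} (hz : z ∈ ⋂ j ∈ carrier θ, U j)
    (hz' : z' ∈ ⋂ j ∈ carrier θ, U j) : C.deform θ 1 z = C.deform θ 1 z' := by
  obtain ⟨ρ, hρ, h⟩ := exists_eventually_one_le_flagWeight θ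
  refine descend_eq_of_one_le (isFlagWeight_flagWeight θ zero_le_one) (ρ := ρ) ?_
    (Finset.card_le_card hρ) (isAdmissible_flagWeight zero_le_one hz _)
    (isAdmissible_flagWeight zero_le_one hz' _)
  rw [one_mul]
  exact h.self_of_nhds

lemma exists_deform_mem (θ : realization (nerve U)) {τ : ℝ} (hτ : 0 ≤ τ) {z : M}
    (hz : z ∈ ⋂ j ∈ carrier θ, U j) : ∃ j ∈ carrier θ, C.deform θ τ z ∈ U j := by
  obtain ⟨j, hj, h⟩ := exists_forall_mem θ
  exact ⟨j, hj, descend_mem (isFlagWeight_flagWeight θ hτ)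
    (fun ρ hρ => h ρ (pos_of_mul_pos_right hρ hτ)) (isAdmissible_flagWeight hτ hz _)
    (mem_iInter₂.1 hz j hj)⟩

/-- The deformed point is locally Lipschitz in parameters if the starting point is so, or if the
deformation is run at full speed throughout. -/
lemma lipschitzNear_deform (hU : IsGoodCovering U) {P : Type*} [PseudoMetricSpace P]
    {θ : P → realization (nerve U)} {τ : P → ℝ} {z : P → M} {a₀ : P} (hθ : LipschitzNear θ a₀)
    (hτ : LipschitzNear τ a₀) (hτ0 : ∀ a, 0 ≤ τ a) (hτ1 : ∀ a, τ a ≤ 1)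
    (hz : ∀ a, z a ∈ ⋂ j ∈ carrier (θ a), U j) (h : LipschitzNear z a₀ ∨ ∀ a, τ a = 1) :
    LipschitzNear (fun a => C.deform (θ a) (τ a) (z a)) a₀ := by
  obtain ⟨S, hS⟩ := exists_eventually_carrier_subset hU (θ a₀)
  obtain ⟨Cw, tw, htw, hw⟩ := exists_lipschitzOnWith_flagWeight (θ a₀)
  obtain ⟨ρ, hρ, hρ1⟩ := exists_eventually_one_le_flagWeight (θ a₀)
  have hcont := hθ.continuousAt
  obtain ⟨Kθ, tθ, htθ, hKθ⟩ := hθ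
  obtain ⟨Kτ, tτ, htτ, hKτ⟩ := hτ
  set A : Set P := {a | carrier (θ a) ⊆ S} ∩ θ ⁻¹' tw ∩ {a | 1 ≤ flagWeight (θ a) ρ} ∩
    (tθ ∩ tτ)
  have hAmem : A ∈ 𝓝 a₀ := inter_mem (inter_mem (inter_mem (hcont hS) (hcont htw)) (hcont hρ1))
    (inter_mem htθ htτ)
  let v : P → Finset J → ℝ := fun a ρ => τ a * flagWeight (θ a) ρ
  have hflag : ∀ a ∈ A, IsFlagWeight U (v a) := fun a _ => isFlagWeight_flagWeight _ (hτ0 a)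
  have hL : ∀ a ∈ A, ∀ ρ, 0 < v a ρ → C.const ρ ≤ ∑ ρ ∈ S.powerset, C.const ρ :=
    fun a ha ρ hpos => Finset.single_le_sum (fun _ _ => zero_le) (Finset.mem_powerset.2
      ((subset_carrier (pos_of_mul_pos_right hpos (hτ0 a))).trans ha.1.1.1))
  have hv : ∀ ρ, LipschitzOnWith (Cw * Kθ + 2 * Kτ) (fun a => v a ρ) A := by
    refine fun ρ => LipschitzOnWith.of_dist_le_mul fun a ha b hb => ?_
    have h1 : |flagWeight (θ a) ρ - flagWeight (θ b) ρ| ≤ Cw * (Kθ * dist a b) := by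
      have h2 := (hw ρ).dist_le_mul _ ha.1.1.2 _ hb.1.1.2
      rw [Real.dist_eq] at h2
      refine h2.trans ?_
      gcongr
      exact hKθ.dist_le_mul a ha.2.1 b hb.2.1
    have h2 : |τ a - τ b| ≤ Kτ * dist a b := by
      simpa [Real.dist_eq] using hKτ.dist_le_mul a ha.2.2 b hb.2.2
    have hid : v a ρ - v b ρ = τ a * (flagWeight (θ a) ρ - flagWeight (θ b) ρ) +
        flagWeight (θ b) ρ * (τ a - τ b) := by
      simp only [v]
      ring
    rw [Real.dist_eq, hid]
    refine (abs_add_le _ _).trans ?_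
    rw [abs_mul, abs_mul, abs_of_nonneg (hτ0 a), abs_of_nonneg (flagWeight_nonneg _ ρ)]
    push_cast
    have h3 := mul_le_mul (hτ1 a) h1 (abs_nonneg _) zero_le_one
    have h4 := mul_le_mul (flagWeight_le_two (θ b) ρ) h2 (abs_nonneg _) zero_le_two
    linarith
  have hadm : ∀ a ∈ A, IsAdmissible U (v a) S.card (z a) := fun a _ =>
    isAdmissible_flagWeight (hτ0 a) (hz a) _
  have heq : ∀ a ∈ A, C.deform (θ a) (τ a) (z a) = C.descend (v a) S.card (z a) := fun a ha =>
    C.deform_eq_descend (hτ0 a) (Finset.card_le_card ha.1.1.1) (z a)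
  have hmain : LipschitzNear (fun a => C.descend (v a) S.card (z a)) a₀ := by
    rcases h with ⟨Kz, tz, htz, hKz⟩ | h1
    · have hsub : A ∩ tz ⊆ A := inter_subset_left
      obtain ⟨K, hK⟩ := exists_lipschitzOnWith_descend (C := C) (A := A ∩ tz)
        (fun a ha => hflag a ha.1) (fun a ha => hL a ha.1)
        (Kw := max (Cw * Kθ + 2 * Kτ) Kz) (Kz := max (Cw * Kθ + 2 * Kτ) Kz)
        (fun ρ => ((hv ρ).mono hsub).weaken (le_max_left _ _))
        ((hKz.mono inter_subset_right).weaken (le_max_right _ _)) fun a ha => hadm a ha.1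
      exact ⟨K, _, inter_mem hAmem htz, hK⟩
    · obtain ⟨K, hK⟩ := exists_lipschitzOnWith_descend_of_one_le hflag hL hv hadm (ρ := ρ)
        (Finset.card_le_card (hρ.trans (mem_of_mem_nhds hAmem).1.1.1)) fun a ha => by
          simp only [v, h1 a, one_mul]
          exact ha.1.2
      exact ⟨K, A, hAmem, hK⟩
  exact hmain.congr (eventually_of_mem hAmem heq)

end ContractionSystem

/-- A locally Lipschitz map to the nerve whose `j`-th coordinate is positive exactly on `U j`
is a locally Lipschitz homotopy equivalence. -/
theorem isLocLipschitzHomotopyEquivalence_of_pos_iff (hU : IsGoodCovering U)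
    {Θ : M → realization (nerve U)} (hΘ : LocallyLipschitz Θ)
    (hpos : ∀ x j, 0 < (Θ x).1 j ↔ x ∈ U j) : IsLocLipschitzHomotopyEquivalence Θ := by
  classical
  obtain ⟨C⟩ := hU.nonempty_contractionSystem
  choose z hz using fun θ : realization (nerve U) => (carrier_mem θ).2
  have hmem : ∀ x, x ∈ ⋂ j ∈ carrier (Θ x), U j := fun x =>
    mem_iInter₂.2 fun j hj => (hpos x j).1 (mem_carrier.1 hj)
  let g : realization (nerve U) → M := fun θ => C.deform θ 1 (z θ)
  have hg : LocallyLipschitz g := fun θ =>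
    C.lipschitzNear_deform hU (.of_lipschitzWith .id θ) (.const 1 θ) (fun _ => zero_le_one)
      (fun _ => le_rfl) hz (.inr fun _ => rfl)
  refine ⟨hΘ, g, hg, ?_, ?_⟩
  · refine ⟨fun q => C.deform (Θ q.1) (1 - q.2) q.1, fun q => ?_, fun x => ?_, fun x => ?_⟩
    · have h2 : LipschitzNear (fun q : M × I => (q.2 : ℝ)) q :=
        LipschitzNear.comp (.of_lipschitzWith (LipschitzWith.subtype_val I) q.2) (.snd q)
      exact C.lipschitzNear_deform hU (LipschitzNear.comp (hΘ q.1) (.fst q))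
        ((LipschitzNear.const (1 : ℝ) q).sub h2) (fun a => sub_nonneg.2 a.2.2.2)
        (fun a => sub_le_self _ a.2.2.1) (fun a => hmem a.1) (.inl (.fst q))
    · simp only [Icc.coe_zero, sub_zero]
      exact C.deform_one_eq (Θ x) (hmem x) (hz (Θ x))
    · simp only [Icc.coe_one, sub_self]
      exact C.deform_zero (Θ x) x
  -- The products of the coordinates of `θ` and of `Θ (g θ)` give a point `ψ θ` whose carrier is
  -- contained in both carriers; the two segments at `ψ θ` stay in the nerve.
  · let c : realization (nerve U) → J → ℝ := fun θ j => (Θ (g θ)).1 j * θ.1 j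
    let n : realization (nerve U) → ℝ := fun θ => ∑ j ∈ carrier θ, c θ j
    have hc0 : ∀ θ j, 0 ≤ c θ j := fun θ j =>
      mul_nonneg (coord_nonneg (Θ (g θ)) j) (coord_nonneg θ j)
    have hcout : ∀ θ j, j ∉ carrier θ → c θ j = 0 := fun θ j hj => by
      simp only [c, coord_eq_zero hj, mul_zero]
    have hn : ∀ θ, 0 < n θ := by
      intro θ
      obtain ⟨j, hj, hgj⟩ := C.exists_deform_mem θ zero_le_one (hz θ)
      exact Finset.sum_pos' (fun i _ => hc0 θ i)
        ⟨j, hj, mul_pos ((hpos (g θ) j).2 hgj) (mem_carrier.1 hj)⟩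
    let ψ : realization (nerve U) → realization (nerve U) := fun θ =>
      ofWeights (fun j => c θ j / n θ) (fun j => div_nonneg (hc0 θ j) (hn θ).le) (carrier θ)
        (carrier_mem θ) (fun j hj => by rw [hcout θ j hj, zero_div])
        (by rw [← Finset.sum_div]; exact div_self (hn θ).ne')
    have hψ : ∀ θ j, (ψ θ).1 j = c θ j / n θ := fun _ _ => rfl
    have hψ1 : ∀ θ, carrier (ψ θ) ⊆ carrier θ := fun θ j hj => by
      by_contra h
      rw [mem_carrier, hψ, hcout θ j h, zero_div] at hj
      exact hj.false
    have hψ2 : ∀ θ, carrier (ψ θ) ⊆ carrier (Θ (g θ)) := fun θ j hj => by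
      by_contra h
      rw [mem_carrier, hψ] at hj
      simp only [c, coord_eq_zero h, zero_mul, zero_div, lt_self_iff_false] at hj
    have hΘg : LocallyLipschitz fun θ => Θ (g θ) := hΘ.comp hg
    have hcoord : ∀ {f : realization (nerve U) → realization (nerve U)} (θ) (j : J),
        LipschitzNear f θ → LipschitzNear (fun a => (f a).1 j) θ := fun θ j hf =>
      LipschitzNear.comp (.of_lipschitzWith (lipschitzWith_coord j) _) hf
    have hψlip : ∀ θ, LipschitzNear (fun a => (ψ a).1) θ := by
      intro θ
      obtain ⟨S, hS⟩ := exists_eventually_carrier_subset hU θ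
      have hcl : ∀ j, LipschitzNear (fun a => c a j) θ := fun j =>
        (hcoord θ j (hΘg θ)).mul (hcoord θ j (.of_lipschitzWith .id θ))
      have hnl : LipschitzNear n θ := by
        refine (LipschitzNear.sum S fun j _ => hcl j).congr ?_
        filter_upwards [hS] with a ha
        exact Finset.sum_subset ha fun j _ hj => hcout a j hj
      refine LipschitzNear.of_coord S ?_ fun j => (hcl j).div hnl (hn θ).ne'
      filter_upwards [hS] with a ha j hj
      exact coord_eq_zero fun h => hj (ha (hψ1 a h))
    -- On `[0, 1/2]` the homotopy runs from `Θ (g θ)` to `ψ θ`, on `[1/2, 1]` from `ψ θ` to `θ`.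
    let r : I → ℝ := fun t => min (2 * (t : ℝ)) 1
    let s : I → ℝ := fun t => max (2 * (t : ℝ) - 1) 0
    let h : realization (nerve U) × I → lp (fun _ : J => ℝ) ∞ := fun q =>
      (Θ (g q.1)).1 + r q.2 • ((ψ q.1).1 - (Θ (g q.1)).1) + s q.2 • (q.1.1 - (ψ q.1).1)
    have hmem' : ∀ q, h q ∈ realization (nerve U) := by
      rintro ⟨θ, t⟩
      rcases le_total (2 * (t : ℝ)) 1 with ht | ht
      · have hr : r t = 2 * t := min_eq_left ht
        have hs : s t = 0 := max_eq_right (by linarith)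
        simp only [h, hr, hs, zero_smul, add_zero]
        exact segment_mem_realization (carrier_mem (Θ (g θ))) (Finset.Subset.refl _) (hψ2 θ)
          (by linarith [t.2.1]) ht
      · have hr : r t = 1 := min_eq_right ht
        have hs : s t = 2 * t - 1 := max_eq_left (by linarith)
        simp only [h, hr, hs, one_smul, add_sub_cancel]
        exact segment_mem_realization (carrier_mem θ) (hψ1 θ) (Finset.Subset.refl _)
          (by linarith) (by linarith [t.2.2])
    refine ⟨fun q => ⟨h q, hmem' q⟩, fun q => ?_, fun θ => ?_, fun θ => ?_⟩
    · have ht : LipschitzNear (fun q : realization (nerve U) × I => 2 * (q.2 : ℝ)) q :=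
        (LipschitzNear.const (2 : ℝ) q).mul
          (LipschitzNear.comp (.of_lipschitzWith (LipschitzWith.subtype_val I) q.2) (.snd q))
      have hr : LipschitzNear (fun q : realization (nerve U) × I => r q.2) q :=
        LipschitzNear.comp (g := fun x : ℝ => min x 1)
          (.of_lipschitzWith (LipschitzWith.id.min_const 1) _) ht
      have hs : LipschitzNear (fun q : realization (nerve U) × I => s q.2) q :=
        LipschitzNear.comp (g := fun x : ℝ => max x 0)
          (.of_lipschitzWith (LipschitzWith.id.max_const 0) _)
          (ht.sub (.const (1 : ℝ) q))
      have h1 : LipschitzNear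
          (fun q : realization (nerve U) × I => (Θ (g q.1)).1) q :=
        LipschitzNear.comp (g := fun θ => (Θ (g θ)).1)
          (LipschitzNear.comp (.of_lipschitzWith (LipschitzWith.subtype_val _) _) (hΘg q.1))
          (.fst q)
      have h2 : LipschitzNear (fun q : realization (nerve U) × I => (ψ q.1).1) q :=
        LipschitzNear.comp (g := fun θ => (ψ θ).1) (hψlip q.1) (.fst q)
      have h3 : LipschitzNear (fun q : realization (nerve U) × I => q.1.1) q :=
        LipschitzNear.comp (.of_lipschitzWith (LipschitzWith.subtype_val _) _) (.fst q)
      exact (h1.add (hr.smul (h2.sub h1))).add (hs.smul (h3.sub h2))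
    · ext1
      simp [h, r, s]
    · ext1
      have hr : r 1 = 1 := by norm_num [r]
      have hs : s 1 = 1 := by norm_num [s]
      simp [h, hr, hs]

/-- On compact spaces locally Lipschitz maps and homotopies are Lipschitz. -/
lemma IsLocLipschitzHomotopyEquivalence.isLipschitz {X Y : Type*} [MetricSpace X] [MetricSpace Y]
    [CompactSpace X] [CompactSpace Y] {f : X → Y} (hf : IsLocLipschitzHomotopyEquivalence f) :
    IsLipschitzHomotopyEquivalence f := by
  obtain ⟨hf, g, hg, ⟨h, hh, h01⟩, ⟨k, hk, k01⟩⟩ := hf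
  exact ⟨.of_locallyLipschitz hf, g, .of_locallyLipschitz hg,
    ⟨h, .of_locallyLipschitz hh, h01⟩, ⟨k, .of_locallyLipschitz hk, k01⟩⟩

lemma compactSpace_realization_nerve [CompactSpace M] (hU : IsGoodCovering U) :
    CompactSpace (realization (nerve U)) := by
  have hfin : {j | (U j).Nonempty}.Finite := hU.locallyFinite.finite_nonempty_of_compact
  refine compactSpace_realization (hfin.toFinset.powerset.finite_toSet.subset fun s hs => ?_)
  obtain ⟨x, hx⟩ := hs.2
  rw [Finset.mem_coe, Finset.mem_powerset]
  exact fun j hj => hfin.mem_toFinset.2 ⟨x, mem_iInter₂.1 hx j hj⟩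

/-- The map given by the partition of unity exists and is a locally Lipschitz homotopy
equivalence, as soon as the points `p j` are chosen in the sets `U j`. -/
lemma exists_isLocLipschitzHomotopyEquivalence (hU : IsGoodCovering U) {p : J → M}
    (hp : ∀ j, (U j).Nonempty → p j ∈ U j) :
    ∃ Θ : M → realization (nerve U), (∀ x j, (Θ x).1 j = partition U p j x) ∧
      IsLocLipschitzHomotopyEquivalence Θ := by
  obtain ⟨Θ, hΘ, hlip⟩ := exists_partition_map hU hp
  refine ⟨Θ, hΘ, isLocLipschitzHomotopyEquivalence_of_pos_iff hU hlip fun x j => ?_⟩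
  rw [hΘ, partition_pos_iff hU]

lemma locLipschitzHomotopyEquivalent_nerve (hU : IsGoodCovering U) :
    LocLipschitzHomotopyEquivalent M (realization (nerve U)) := by
  rcases isEmpty_or_nonempty M with hM | hM
  -- Over the empty space there may be indices `j`, but no points `p j`.
  · exact ⟨isEmptyElim, isLocLipschitzHomotopyEquivalence_of_pos_iff hU
      (fun x => isEmptyElim x) fun x => isEmptyElim x⟩
  · classical
    obtain ⟨Θ, -, hΘ⟩ := exists_isLocLipschitzHomotopyEquivalence hU
      (p := fun j => if h : (U j).Nonempty then h.some else hM.some) fun j h => by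
        rw [dif_pos h]
        exact h.some_mem
    exact ⟨Θ, hΘ⟩

end Main

end LipNerve

end

theorem theorem1p1 {M : Type*} [MetricSpace M] [SigmaCompactSpace M] {J : Type*}
    (U : J → Set M) (hU : LipNerve.IsGoodCovering U) :
    LipNerve.LocLipschitzHomotopyEquivalent M (LipNerve.realization (LipNerve.nerve U)) ∧
    (CompactSpace M →
      LipNerve.LipschitzHomotopyEquivalent M (LipNerve.realization (LipNerve.nerve U)) ∧
      ∀ p : J → M, (∀ j, (U j).Nonempty → LipNerve.IsCenter (U j) (p j)) →
        ∃ Θ : M → LipNerve.realization (LipNerve.nerve U),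
          (∀ x j, (Θ x : lp (fun _ : J => ℝ) ⊤) j = LipNerve.partition U p j x) ∧
          LipNerve.IsLipschitzHomotopyEquivalence Θ) := by
  have hloc := LipNerve.locLipschitzHomotopyEquivalent_nerve hU
  refine ⟨hloc, fun hM => ?_⟩
  have hN := LipNerve.compactSpace_realization_nerve hU
  refine ⟨hloc.imp fun Θ hΘ => hΘ.isLipschitz, fun p hp => ?_⟩
  obtain ⟨Θ, hΘ, hequiv⟩ :=
    LipNerve.exists_isLocLipschitzHomotopyEquivalence hU fun j hj => (hp j hj).1
  exact ⟨Θ, hΘ, hequiv.isLipschitz⟩
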